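/- For $B\in\mathbb C^{n\times n}$ and a function $g$ analytic in a neighbourhood of the spectrum $\sigma(B)$, let $$g(B)=\frac1{2\pi i}\int_\Gamma g(\lambda)(\lambda\mathbf 1-B)^{-1}\,d\lambda,$$ where the contour $\Gamma$ lies in the domain of $g$ and encloses $\sigma(B)$ (for instance, $\Gamma$ consists of positively oriented circles of a sufficiently small radius about the eigenvalues of $B$). Let $A\in\mathbb C^{n\times n}$, let $N\ge1$, and let $z_1,\dots,z_N\in\mathbb C$ be points that are not necessarily distinct; the multiplicity $n_k$ of $z_k$ is the number of indices $i$ with $z_i=z_k$. Let $f$ be an analytic function defined on an open set containing the convex hull of $\sigma(A)\cup\{z_1,\dots,z_N\}$. Let $u$ and $v$ be complex polynomials such that $\deg u\le N-1$, $v(z_k)\ne0$ for $k=1,\dots,N$, and $v(\lambda)\ne0$ for all $\lambda\in\sigma(A)$, and suppose that the rational function $r=u/v$ satisfies the interpolation conditions $$r^{(j)}(z_k)=f^{(j)}(z_k),\qquad k=1,\dots,N,\quad j=0,1,\dots,n_k-1.$$ Put $\Omega(z)=\prod_{k=1}^N(z-z_k)$. Then for every linear functional $\xi$ on $\mathbb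 C^{n\times n}$ the maximum below exists, and $$\bigl|\xi\bigl[f(A)-r(A)\bigr]\bigr|\le\max_{\substack{t\in[0,1]\\ \mu\in\operatorname{co}\{z_1,\dots,z_N\}}}\left|\xi\left[\Omega(A)[v(A)]^{-1}\frac{(vf)^{(N)}\bigl((1-t)\mu\mathbf 1+tA\bigr)}{N!}\right]\right|,$$ where $\operatorname{co}$ denotes the convex hull. -/

import Mathlib

open Filter Topology

noncomputable section

/-- The contour integral `(2πi)⁻¹ ∫_Γ f(λ) (λ1 - A)⁻¹ dλ` (computed entrywise), where the contour `Γ`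
consists of the positively oriented circles of radius `ε` centred at the eigenvalues of `A`. -/
def contourCalculus {n : ℕ} (f : ℂ → ℂ) (A : Matrix (Fin n) (Fin n) ℂ) (ε : ℝ) :
    Matrix (Fin n) (Fin n) ℂ :=
  ∑ c ∈ (Matrix.finite_spectrum A).toFinset,
    Matrix.of fun i j =>
      (2 * Real.pi * Complex.I : ℂ)⁻¹ *
        ∮ z in C(c, ε), f z * ((z • (1 : Matrix (Fin n) (Fin n) ℂ) - A)⁻¹) i j

/-- The function `f` applied to the matrix `A`:
`f(A) = (2πi)⁻¹ ∫_Γ f(λ) (λ1 - A)⁻¹ dλ`, where `Γ` encloses the spectrum of `A`.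
As `Γ` we take the union of circles of radius `ε` about the eigenvalues; if `f` is analytic near
the spectrum, then the integral does not depend on `ε` for all small `ε > 0`,
so the limit below is this common value. -/
def matrixFunction {n : ℕ} (f : ℂ → ℂ) (A : Matrix (Fin n) (Fin n) ℂ) :
    Matrix (Fin n) (Fin n) ℂ :=
  limUnder (𝓝[>] (0 : ℝ)) (contourCalculus f A)

/-- The definition is proper: for `f` analytic near the spectrum, `matrixFunction f A` is the contour
integral over the circles of radius `ε`, for all small `ε > 0`. -/
theorem matrixFunction_eq_contourCalculus {n : ℕ} (f : ℂ → ℂ) (A : Matrix (Fin n) (Fin n) ℂ)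
    (hf : AnalyticOnNhd ℂ f (spectrum ℂ A)) :
    ∀ᶠ ε in 𝓝[>] (0 : ℝ), contourCalculus f A ε = matrixFunction f A := by
  have hfin := Matrix.finite_spectrum A
  have hev : ∀ c ∈ spectrum ℂ A, ∀ᶠ w in 𝓝 c,
      DifferentiableAt ℂ f w ∧ (w ∈ spectrum ℂ A → w = c) := by
    intro c hc
    have h1 : ∀ᶠ w in 𝓝 c, DifferentiableAt ℂ f w :=
      (hf c hc).eventually_analyticAt.mono fun w hw => hw.differentiableAt
    have h2 : ∀ᶠ w in 𝓝 c, w ∈ (spectrum ℂ A \ {c})ᶜ :=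
      (hfin.subset Set.sdiff_subset).isClosed.isOpen_compl.mem_nhds (by simp)
    filter_upwards [h1, h2] with w hw1 hw2
    exact ⟨hw1, fun hw => by_contra fun hne => hw2 ⟨hw, hne⟩⟩
  have hrad : ∀ᶠ δ in 𝓝[>] (0 : ℝ), ∀ c ∈ spectrum ℂ A, ∀ w ∈ Metric.closedBall c δ,
      DifferentiableAt ℂ f w ∧ (w ∈ spectrum ℂ A → w = c) := by
    rw [hfin.eventually_all]
    intro c hc
    obtain ⟨δ, hδ, h⟩ := Metric.eventually_nhds_iff_ball.1 (hev c hc)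
    filter_upwards [Ioo_mem_nhdsGT hδ] with ε hε w hw
    exact h w (Metric.closedBall_subset_ball hε.2 hw)
  obtain ⟨δ, hδ, hδ0⟩ := (hrad.and self_mem_nhdsWithin).exists
  have hδ0 : 0 < δ := hδ0
  have hdiff : ∀ i j, ∀ w, w ∉ spectrum ℂ A → DifferentiableAt ℂ
      (fun z : ℂ => ((z • (1 : Matrix (Fin n) (Fin n) ℂ) - A)⁻¹) i j) w := by
    intro i j w hw
    have hu : IsUnit (w • (1 : Matrix (Fin n) (Fin n) ℂ) - A).det := by
      rw [← Matrix.isUnit_iff_isUnit_det]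
      have := spectrum.notMem_iff.1 hw
      rwa [Algebra.algebraMap_eq_smul_one] at this
    have hE : ∀ a b, Differentiable ℂ
        (fun z : ℂ => (z • (1 : Matrix (Fin n) (Fin n) ℂ) - A) a b) := by
      intro a b
      simp only [Matrix.sub_apply, Matrix.smul_apply]
      fun_prop
    have hdet : ∀ M : ℂ → Matrix (Fin n) (Fin n) ℂ,
        (∀ a b, Differentiable ℂ fun z => M z a b) → Differentiable ℂ fun z => (M z).det := by
      intro M hM
      simp only [Matrix.det_apply]
      fun_prop
    have hadj : Differentiable ℂ
        (fun z : ℂ => (z • (1 : Matrix (Fin n) (Fin n) ℂ) - A).adjugate i j) := by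
      simp only [Matrix.adjugate_apply]
      apply hdet
      intro a b
      by_cases h : a = j
      · subst h
        simp
      · simp only [Matrix.updateRow_ne h]
        exact hE a b
    simp only [Matrix.inv_def, Ring.inverse_eq_inv', Matrix.smul_apply, smul_eq_mul]
    exact ((hdet _ hE w).inv hu.ne_zero).mul (hadj w)
  have hconst : ∀ ε ∈ Set.Ioc 0 δ, contourCalculus f A ε = contourCalculus f A δ := by
    intro ε hε
    unfold contourCalculus
    refine Finset.sum_congr rfl fun c hc => ?_
    have hc : c ∈ spectrum ℂ A := by simpa using hc
    ext i j
    simp only [Matrix.of_apply]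
    congr 1
    have hd : ∀ w ∈ Metric.closedBall c δ \ Metric.ball c ε, DifferentiableAt ℂ
        (fun z : ℂ => f z * ((z • (1 : Matrix (Fin n) (Fin n) ℂ) - A)⁻¹) i j) w := by
      intro w hw
      refine (hδ c hc w hw.1).1.mul (hdiff i j w fun hs => ?_)
      exact hw.2 ((hδ c hc w hw.1).2 hs ▸ Metric.mem_ball_self hε.1)
    refine (Complex.circleIntegral_eq_of_differentiable_on_annulus_off_countable hε.1 hε.2
      Set.countable_empty (fun w hw => (hd w hw).continuousAt.continuousWithinAt) ?_).symm
    intro w hw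
    exact hd w ⟨Metric.ball_subset_closedBall hw.1.1,
      fun h => hw.1.2 (Metric.ball_subset_closedBall h)⟩
  have hevc : ∀ᶠ ε in 𝓝[>] (0 : ℝ), contourCalculus f A ε = contourCalculus f A δ := by
    filter_upwards [Ioc_mem_nhdsGT hδ0] with ε hε using hconst ε hε
  have hlim : matrixFunction f A = contourCalculus f A δ :=
    (tendsto_const_nhds.congr' (hevc.mono fun _ h => h.symm)).limUnder_eq
  rw [hlim]
  exact hevc

/-- The multiplicity of the `k`-th node: how many times `z k` is repeated in the list `z`. -/
def nodeMultiplicity {N : ℕ} (z : Fin N → ℂ) (k : Fin N) : ℕ :=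
  Nat.card {i : Fin N // z i = z k}

/-- `r` satisfies the interpolation conditions `r^{(j)}(z_k) = f^{(j)}(z_k)` for all nodes `z_k` and
all `j` less than the multiplicity of `z_k`. -/
def Interpolates {N : ℕ} (r f : ℂ → ℂ) (z : Fin N → ℂ) : Prop :=
  ∀ k : Fin N, ∀ j < nodeMultiplicity z k, iteratedDeriv j r (z k) = iteratedDeriv j f (z k)

/-- `Ω(X) = ∏ (X - z_k)`. -/
def nodePolynomial {N : ℕ} (z : Fin N → ℂ) : Polynomial ℂ :=
  ∏ k, (Polynomial.X - Polynomial.C (z k))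

/-- `Ω(A) v(A)⁻¹ (v f)^{(N)}((1 - t) μ 1 + t A) / N!`. -/
def remainderMatrix {n N : ℕ} (A : Matrix (Fin n) (Fin n) ℂ) (z : Fin N → ℂ) (f : ℂ → ℂ)
    (v : Polynomial ℂ) (t : ℝ) (μ : ℂ) : Matrix (Fin n) (Fin n) ℂ :=
  Polynomial.aeval A (nodePolynomial z) * (Polynomial.aeval A v)⁻¹ *
    ((N.factorial : ℂ)⁻¹ •
      matrixFunction (iteratedDeriv N fun w => v.eval w * f w)
        (((1 - (t : ℂ)) * μ) • (1 : Matrix (Fin n) (Fin n) ℂ) + (t : ℂ) • A))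

end

/-! The interpolation conditions say that h = vf - u = Ωφ with φ analytic, whence f(A) - r(A) = Ω(A)
v(A)⁻¹ φ(A). Here φ is the divided difference of h at the nodes and a further point. By the
Hermite–Genocchi formula it is an integral of h^(N) over a simplex of volume 1/N!, and h^(N) =
(vf)^(N) because deg u < N. The arguments of h^(N) have the form (1-t)μ + tw with μ in the hull of
the nodes, and ξ passes under the integral.

The simplex integral is replaced by an induction that removes one node at a time. If h = (w-a)g,
then s^(p+1) g^(p)(a + s(w-a)) has s-derivative s^p h^(p+1)(a + s(w-a)), so a bound C for h^(p+1)
gives C/(p+1) for g^(p); the product of these factors is 1/N!. The maps w ↦ (1-t)μ + tw are stable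
under composition with homotheties centred at nodes, so one family of maps serves throughout
(`norm_sum_iteratedDeriv_le_of_prod_factor`).

Matrices are reduced to scalars by a spectral resolution 1 = ∑ E_c with (A-c)^n E_c = 0: a
functional of g((1-t)μ + tA) becomes a combination of t^j g^(j)((1-t)μ + tc) whose coefficients
depend on neither t, μ nor g (`matrixFunction_affine_eq_sum`). -/

/-! ### Iterated derivatives and linear factors -/

theorem AnalyticOnNhd.analyticOnNhd_iteratedDeriv {f : ℂ → ℂ} {U : Set ℂ}
    (hf : AnalyticOnNhd ℂ f U) (p : ℕ) :
    AnalyticOnNhd ℂ (iteratedDeriv p f) U := by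
  rw [iteratedDeriv_eq_iterate]
  exact hf.iterated_deriv p

theorem AnalyticOnNhd.hasDerivAt_iteratedDeriv {f : ℂ → ℂ} {U : Set ℂ}
    (hf : AnalyticOnNhd ℂ f U) (p : ℕ) {w : ℂ} (hw : w ∈ U) :
    HasDerivAt (iteratedDeriv p f) (iteratedDeriv (p + 1) f w) w := by
  rw [iteratedDeriv_succ]
  exact (hf.analyticOnNhd_iteratedDeriv p w hw).differentiableAt.hasDerivAt

theorem iteratedDeriv_iteratedDeriv (p q : ℕ) (f : ℂ → ℂ) :
    iteratedDeriv p (iteratedDeriv q f) = iteratedDeriv (q + p) f := by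
  simp only [iteratedDeriv_eq_iterate, ← Function.iterate_add_apply, add_comm]

/-- Leibniz rule for the product with a linear factor. -/
theorem iteratedDeriv_succ_sub_mul {U : Set ℂ} (hU : IsOpen U) {g h : ℂ → ℂ} {a : ℂ}
    (hg : AnalyticOnNhd ℂ g U) (hh : ∀ w ∈ U, h w = (w - a) * g w) (p : ℕ) :
    ∀ w ∈ U, iteratedDeriv (p + 1) h w =
      (w - a) * iteratedDeriv (p + 1) g w + (p + 1) * iteratedDeriv p g w := by
  induction p with
  | zero =>
    intro w hw
    have h1 : h =ᶠ[𝓝 w] fun w => (w - a) * g w := by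
      filter_upwards [hU.mem_nhds hw] with x hx using hh x hx
    have h2 := ((hasDerivAt_id w).sub_const a).mul (hg.hasDerivAt_iteratedDeriv 0 hw)
    rw [h1.iteratedDeriv_eq, iteratedDeriv_succ, iteratedDeriv_zero]
    simp only [iteratedDeriv_zero] at h2
    refine h2.deriv.trans ?_
    simp
    ring
  | succ p ih =>
    intro w hw
    have h1 : iteratedDeriv (p + 1) h =ᶠ[𝓝 w] fun w =>
        (w - a) * iteratedDeriv (p + 1) g w + (p + 1) * iteratedDeriv p g w := by
      filter_upwards [hU.mem_nhds hw] with x hx using ih x hx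
    have h2 := (((hasDerivAt_id w).sub_const a).mul (hg.hasDerivAt_iteratedDeriv (p + 1) hw)).add
      ((hg.hasDerivAt_iteratedDeriv p hw).const_mul ((p : ℂ) + 1))
    rw [iteratedDeriv_succ, h1.deriv_eq]
    refine h2.deriv.trans ?_
    simp
    ring

/-! ### Estimates of Hermite–Genocchi type -/

/-- If `h = (w - a) g`, then a bound for a combination of values of `h^{(p+1+j)}` along the
homotheties centred at `a` gives a bound for the same combination of `g^{(p+j)}`. -/
theorem norm_sum_iteratedDeriv_le_of_linear_factor {ι : Type*} (S : Finset ι) {U K : Set ℂ}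
    (hU : IsOpen U) (hK : Convex ℝ K) (hKU : K ⊆ U) {g h : ℂ → ℂ} {a : ℂ} (ha : a ∈ K)
    (hg : AnalyticOnNhd ℂ g U) (hh : ∀ w ∈ U, h w = (w - a) * g w) (p m : ℕ)
    (b : ι → ℕ → ℂ) (c : ι → ℂ) (hc : ∀ i ∈ S, c i ∈ K) (C : ℝ)
    (hC : ∀ s ∈ Set.Icc (0 : ℝ) 1, ‖∑ i ∈ S, ∑ j ∈ Finset.range m,
      b i j * (s : ℂ) ^ j * iteratedDeriv (p + 1 + j) h ((1 - (s : ℂ)) * a + s * c i)‖ ≤ C) :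
    ‖∑ i ∈ S, ∑ j ∈ Finset.range m, b i j * iteratedDeriv (p + j) g (c i)‖ ≤ C / (p + 1) := by
  have hmem : ∀ s ∈ Set.Icc (0 : ℝ) 1, ∀ i ∈ S, (1 - (s : ℂ)) * a + s * c i ∈ U := by
    intro s hs i hi
    have := hK ha (hc i hi) (sub_nonneg.2 hs.2) hs.1 (by ring)
    apply hKU
    simpa using this
  -- The power s^(p+1+j) makes the Leibniz rule for (w-a)g collapse each derivative to s^(p+j)
  -- h^(p+1+j). Moreover F(0) = 0, and F(1) is the sum to be bounded.
  let F : ℝ → ℂ := fun s => ∑ i ∈ S, ∑ j ∈ Finset.range m,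
    b i j * ((s : ℂ) ^ (p + 1 + j) * iteratedDeriv (p + j) g ((1 - (s : ℂ)) * a + s * c i))
  let F' : ℝ → ℂ := fun s => (s : ℂ) ^ p * ∑ i ∈ S, ∑ j ∈ Finset.range m,
      b i j * (s : ℂ) ^ j * iteratedDeriv (p + 1 + j) h ((1 - (s : ℂ)) * a + s * c i)
  have hF : ∀ s ∈ Set.Icc (0 : ℝ) 1, HasDerivAt F (F' s) s := by
    intro s hs
    simp only [F', Finset.mul_sum]
    refine HasDerivAt.fun_sum fun i hi => HasDerivAt.fun_sum fun j _ => ?_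
    have h1 : HasDerivAt (fun s : ℂ => (1 - s) * a + s * c i) (c i - a) (s : ℂ) := by
      have := (((hasDerivAt_id (s : ℂ)).const_sub 1).mul_const a).add
        ((hasDerivAt_id (s : ℂ)).mul_const (c i))
      convert! this using 1
      ring
    have h2 := (hg.hasDerivAt_iteratedDeriv (p + j) (hmem s hs i hi)).comp (s : ℂ) h1
    have h3 := (((hasDerivAt_pow (p + 1 + j) (s : ℂ)).mul h2).const_mul (b i j)).comp_ofReal
    convert! h3 using 1
    have h4 := iteratedDeriv_succ_sub_mul hU hg hh (p + j) _ (hmem s hs i hi)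
    rw [show p + 1 + j = p + j + 1 by ring, h4, Nat.add_sub_cancel]
    simp only [Function.comp_apply]
    push_cast
    ring
  -- Comparison with the majorant s^(p+1) C/(p+1), whose derivative is s^p C, takes the place of
  -- integration.
  have key := image_norm_le_of_norm_deriv_right_le_deriv_boundary' (f := F) (f' := F')
    (a := 0) (b := 1) (B := fun s => s ^ (p + 1) * (C / (p + 1))) (B' := fun s => s ^ p * C)
    (fun s hs => (hF s hs).continuousAt.continuousWithinAt)
    (fun s hs => (hF s ⟨hs.1, hs.2.le⟩).hasDerivWithinAt) (by simp [F, pow_add])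
    (by fun_prop)
    (fun s _ => by
      have := (hasDerivAt_pow (p + 1) s).mul_const (C / (p + 1))
      refine (this.congr_deriv ?_).hasDerivWithinAt
      push_cast
      field_simp)
    (fun s hs => by
      simp only [F', norm_mul, norm_pow, Complex.norm_real, Real.norm_of_nonneg hs.1]
      exact mul_le_mul_of_nonneg_left (hC s ⟨hs.1, hs.2.le⟩) (pow_nonneg hs.1 _))
    (Set.right_mem_Icc.2 zero_le_one)
  simpa [F] using key

/-- An estimate for the quotient of `h` by the node polynomial in terms of the derivatives of `h`,
for a functional that is a combination of derivatives at given points. -/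
theorem norm_sum_iteratedDeriv_le_of_prod_factor {ι : Type*} (S : Finset ι) {U K K' : Set ℂ}
    (hU : IsOpen U) (hK : Convex ℝ K) (hKU : K ⊆ U) (hK' : Convex ℝ K') (hK'K : K' ⊆ K)
    (hne : K'.Nonempty) (m : ℕ) (b : ι → ℕ → ℂ) (c : ι → ℂ) (hc : ∀ i ∈ S, c i ∈ K)
    {φ : ℂ → ℂ} (hφ : AnalyticOnNhd ℂ φ U) (l : List ℂ) (hl : ∀ a ∈ l, a ∈ K') (h : ℂ → ℂ)
    (hh : ∀ w ∈ U, h w = (l.map fun a => w - a).prod * φ w) (C : ℝ)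
    (hC : ∀ t ∈ Set.Icc (0 : ℝ) 1, ∀ μ ∈ K', ‖∑ i ∈ S, ∑ j ∈ Finset.range m,
      b i j * (t : ℂ) ^ j * iteratedDeriv (l.length + j) h ((1 - (t : ℂ)) * μ + t * c i)‖ ≤ C) :
    ‖∑ i ∈ S, ∑ j ∈ Finset.range m, b i j * iteratedDeriv j φ (c i)‖ ≤ C / l.length.factorial := by
  induction l generalizing h C with
  | nil =>
    obtain ⟨μ, hμ⟩ := hne
    -- At t = 1 the point (1-t)μ + t c_i is c_i, whatever μ is.
    have := hC 1 (by simp) μ hμ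
    have h1 : ∀ i ∈ S, ∀ j, iteratedDeriv j h (c i) = iteratedDeriv j φ (c i) := fun i hi j =>
      Set.EqOn.iteratedDeriv_of_isOpen (fun w hw => by simpa using hh w hw) hU j (hKU (hc i hi))
    simp only [List.length_nil, zero_add, Complex.ofReal_one, one_pow, mul_one, sub_self, zero_mul,
      one_mul] at this
    simp only [List.length_nil, Nat.factorial_zero, Nat.cast_one, div_one]
    refine le_of_eq_of_le (congrArg _ ?_) this
    exact Finset.sum_congr rfl fun i hi => Finset.sum_congr rfl fun j _ => by rw [h1 i hi]
  | cons a l ih =>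
    have hl' : ∀ x ∈ l, x ∈ K' := fun x hx => hl x (List.mem_cons_of_mem _ hx)
    have ha : a ∈ K' := hl a List.mem_cons_self
    let g : ℂ → ℂ := fun w => (l.map fun a => w - a).prod * φ w
    have hprod : ∀ l : List ℂ, AnalyticOnNhd ℂ (fun w => (l.map fun a => w - a).prod) U := by
      intro l
      induction l with
      | nil => simpa using analyticOnNhd_const
      | cons a l ih =>
        simpa using (analyticOnNhd_id.sub analyticOnNhd_const).mul ih
    have hg : AnalyticOnNhd ℂ g U := (hprod l).mul hφ
    -- The factor w - a is removed with the points (1-t)μ + t c_i in place of c_i; the weights t^j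
    -- are absorbed into the coefficients.
    have := ih hl' g (fun w _ => rfl) (C / (l.length + 1)) (fun t ht μ hμ => by
      refine norm_sum_iteratedDeriv_le_of_linear_factor S hU hK hKU (hK'K ha) hg
        (h := h) (fun w hw => by simp [g, hh w hw, mul_assoc]) l.length m
        (fun i j => b i j * (t : ℂ) ^ j) _ (fun i hi => ?_) C (fun s hs => ?_)
      · have := hK (hK'K hμ) (hc i hi) (sub_nonneg.2 ht.2) ht.1 (by ring)
        simpa using this
      · have hst : s * t ∈ Set.Icc (0 : ℝ) 1 :=
          ⟨mul_nonneg hs.1 ht.1, mul_le_one₀ hs.2 ht.1 ht.2⟩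
        -- The composed map has ratio st; its centre ν is the mean of a and μ with weights 1-s and
        -- s(1-t), whose sum is 1-st. If st = 1, both sides vanish and any ν will do.
        obtain ⟨ν, hν, hνeq⟩ : ∃ ν ∈ K', (1 - (s : ℂ) * t) * ν =
            (1 - (s : ℂ)) * a + s * ((1 - (t : ℂ)) * μ) := by
          rcases hst.2.eq_or_lt with h1 | h1
          · have hs1 : s = 1 := le_antisymm hs.2 (h1 ▸ mul_le_of_le_one_right hs.1 ht.2)
            have ht1 : t = 1 := by simpa [hs1] using h1
            exact ⟨a, ha, by simp [hs1, ht1]⟩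
          · have hpos : 0 < 1 - s * t := by linarith
            have hpos' : (1 - (s : ℂ) * t) ≠ 0 := by exact_mod_cast hpos.ne'
            refine ⟨((1 - s) / (1 - s * t)) • a + (s * (1 - t) / (1 - s * t)) • μ,
              hK' ha hμ (div_nonneg (sub_nonneg.2 hs.2) hpos.le)
                (div_nonneg (mul_nonneg hs.1 (sub_nonneg.2 ht.2)) hpos.le) ?_, ?_⟩
            · field_simp
              ring
            · simp only [Complex.real_smul]
              push_cast
              field_simp
        refine le_of_eq_of_le (congrArg _ ?_) (hC (s * t) hst ν hν)
        refine Finset.sum_congr rfl fun i hi => Finset.sum_congr rfl fun j _ => ?_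
        rw [Complex.ofReal_mul, hνeq, List.length_cons, mul_pow,
          show (1 - (s : ℂ)) * a + s * ((1 - (t : ℂ)) * μ + t * c i) =
            (1 - (s : ℂ)) * a + s * ((1 - (t : ℂ)) * μ) + s * t * c i by ring]
        ring)
    refine this.trans_eq ?_
    rw [List.length_cons, Nat.factorial_succ]
    push_cast
    rw [div_div]

/-! ### Division by the node polynomial -/

/-- Division of an analytic function by a product of linear factors. -/
theorem exists_analyticOnNhd_prod_mul_eq {U : Set ℂ} (hU : IsOpen U) (l : List ℂ)
    (hl : ∀ a ∈ l, a ∈ U) (h : ℂ → ℂ) (hh : AnalyticOnNhd ℂ h U)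
    (hord : ∀ a ∈ l, (l.count a : ℕ∞) ≤ analyticOrderAt h a) :
    ∃ φ : ℂ → ℂ, AnalyticOnNhd ℂ φ U ∧ ∀ w ∈ U, h w = (l.map fun a => w - a).prod * φ w := by
  induction l generalizing h with
  | nil => exact ⟨h, hh, by simp⟩
  | cons a l ih =>
    have haU : a ∈ U := hl a List.mem_cons_self
    have hl' : ∀ x ∈ l, x ∈ U := fun x hx => hl x (List.mem_cons_of_mem _ hx)
    have ha : h a = 0 := by
      have h1 := hord a List.mem_cons_self
      refine apply_eq_zero_of_analyticOrderAt_ne_zero fun h0 => ?_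
      rw [h0] at h1
      simp at h1
    -- The quotient h/(w-a), completed by h'(a) at a, is analytic by removal of the singularity.
    have hg : AnalyticOnNhd ℂ (dslope h a) U :=
      ((Complex.differentiableOn_dslope (hU.mem_nhds haU)).2 hh.differentiableOn).analyticOnNhd hU
    have hfac : h = (fun w => w - a) * dslope h a := by
      ext w
      simpa using (sub_smul_dslope_of_zero ha w).symm
    have hlin : ∀ x, AnalyticAt ℂ (fun w : ℂ => w - a) x := fun x => by fun_prop
    obtain ⟨φ, hφ, hφeq⟩ := ih hl' (dslope h a) hg (fun x hx => by
      have h1 := hord x (List.mem_cons_of_mem _ hx)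
      rw [hfac, analyticOrderAt_mul (hlin x) (hg x (hl' x hx))] at h1
      by_cases hxa : x = a
      · subst hxa
        rw [analyticOrderAt_id_sub_const_self, List.count_cons_self, Nat.cast_add, Nat.cast_one,
          add_comm] at h1
        exact (ENat.add_le_add_iff_left (by simp)).1 h1
      · rw [(hlin x).analyticOrderAt_eq_zero.2 (sub_ne_zero.2 hxa), zero_add,
          List.count_cons_of_ne (Ne.symm hxa)] at h1
        exact h1)
    refine ⟨φ, hφ, fun w hw => ?_⟩
    rw [hfac]
    simp [hφeq w hw, mul_assoc]

/-! ### Matrix functions through a spectral resolution -/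

/-- The partial fraction expansion of the resolvent along a resolution of the identity into
matrices that are annihilated by powers of `B - c i`. -/
theorem inv_smul_one_sub_eq_sum {n : ℕ} {ι : Type*} (S : Finset ι)
    (B : Matrix (Fin n) (Fin n) ℂ) (c : ι → ℂ) (E : ι → Matrix (Fin n) (Fin n) ℂ) (m : ℕ)
    (hE : ∑ i ∈ S, E i = 1) (hnil : ∀ i ∈ S, (B - c i • 1) ^ m * E i = 0)
    {w : ℂ} (hw : ∀ i ∈ S, w ≠ c i) :
    (w • (1 : Matrix (Fin n) (Fin n) ℂ) - B)⁻¹ =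
      ∑ i ∈ S, ∑ j ∈ Finset.range m, ((w - c i) ^ (j + 1))⁻¹ • ((B - c i • 1) ^ j * E i) := by
  apply Matrix.inv_eq_right_inv
  rw [Finset.mul_sum]
  refine Eq.trans (Finset.sum_congr rfl fun i hi => ?_) hE
  have hwc : w - c i ≠ 0 := sub_ne_zero.2 (hw i hi)
  -- Writing w - B = (w - c_i) - (B - c_i) makes the sum over j telescope to E_i, the last term
  -- being killed by nilpotency.
  have hterm : ∀ j, (w • (1 : Matrix (Fin n) (Fin n) ℂ) - B) *
      (((w - c i) ^ (j + 1))⁻¹ • ((B - c i • 1) ^ j * E i)) =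
      ((w - c i) ^ j)⁻¹ • ((B - c i • 1) ^ j * E i) -
        ((w - c i) ^ (j + 1))⁻¹ • ((B - c i • 1) ^ (j + 1) * E i) := by
    intro j
    have h1 : w • (1 : Matrix (Fin n) (Fin n) ℂ) - B = (w - c i) • 1 - (B - c i • 1) := by
      rw [sub_smul]
      abel
    rw [h1, sub_mul, smul_mul_smul_comm, one_mul, mul_smul_comm, ← mul_assoc, ← pow_succ']
    congr 2
    rw [pow_succ]
    field_simp
  rw [Finset.mul_sum, Finset.sum_congr rfl fun j _ => hterm j, Finset.sum_range_sub', hnil i hi]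
  simp

theorem circleIntegral_mul_inv_pow_of_ne {f : ℂ → ℂ} {a c : ℂ} {ε : ℝ} (hε : 0 < ε)
    (hf : DifferentiableOn ℂ f (Metric.closedBall a ε)) (hc : c ∉ Metric.closedBall a ε) (j : ℕ) :
    (∮ w in C(a, ε), f w * ((w - c) ^ (j + 1))⁻¹) = 0 := by
  have hd : DifferentiableOn ℂ (fun w => f w * ((w - c) ^ (j + 1))⁻¹) (Metric.closedBall a ε) := by
    refine hf.mul (DifferentiableOn.inv (by fun_prop) fun w hw => pow_ne_zero _ ?_)
    exact sub_ne_zero.2 fun h => hc (h ▸ hw)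
  exact ((hd.mono Metric.closure_ball_subset_closedBall).diffContOnCl).circleIntegral_eq_zero hε.le

theorem circleIntegral_mul_inv_pow_self {f : ℂ → ℂ} {c : ℂ} {ε : ℝ} (hε : 0 < ε)
    (hf : DifferentiableOn ℂ f (Metric.closedBall c ε)) (j : ℕ) :
    (∮ w in C(c, ε), f w * ((w - c) ^ (j + 1))⁻¹) =
      2 * Real.pi * Complex.I * ((j.factorial : ℂ)⁻¹ * iteratedDeriv j f c) := by
  have := hf.circleIntegral_one_div_sub_center_pow_smul hε j
  simp only [one_div, smul_eq_mul, mul_comm _ (f _)] at this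
  rw [this]
  ring

/-- The matrix function as a combination of values of derivatives at the eigenvalues. -/
theorem matrixFunction_eq_sum {n : ℕ} {ι : Type*} (S : Finset ι)
    (B : Matrix (Fin n) (Fin n) ℂ) (c : ι → ℂ) (E : ι → Matrix (Fin n) (Fin n) ℂ) (m : ℕ)
    (hE : ∑ i ∈ S, E i = 1) (hnil : ∀ i ∈ S, (B - c i • 1) ^ m * E i = 0)
    (hc : ∀ i ∈ S, c i ∈ spectrum ℂ B) (f : ℂ → ℂ) (hf : AnalyticOnNhd ℂ f (spectrum ℂ B)) :
    matrixFunction f B = ∑ i ∈ S, ∑ j ∈ Finset.range m,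
      ((j.factorial : ℂ)⁻¹ * iteratedDeriv j f (c i)) • ((B - c i • 1) ^ j * E i) := by
  have hfin := Matrix.finite_spectrum B
  have hrad : ∀ᶠ ε in 𝓝[>] (0 : ℝ), ∀ a ∈ spectrum ℂ B, ∀ w ∈ Metric.closedBall a ε,
      DifferentiableAt ℂ f w ∧ (w ∈ spectrum ℂ B → w = a) := by
    rw [hfin.eventually_all]
    intro a ha
    have h1 : ∀ᶠ w in 𝓝 a, DifferentiableAt ℂ f w :=
      (hf a ha).eventually_analyticAt.mono fun w hw => hw.differentiableAt
    have h2 : ∀ᶠ w in 𝓝 a, w ∈ (spectrum ℂ B \ {a})ᶜ :=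
      (hfin.subset Set.sdiff_subset).isClosed.isOpen_compl.mem_nhds (by simp)
    obtain ⟨δ, hδ, h⟩ := Metric.eventually_nhds_iff_ball.1 (h1.and h2)
    filter_upwards [Ioo_mem_nhdsGT hδ] with ε hε w hw
    obtain ⟨h3, h4⟩ := h w (Metric.closedBall_subset_ball hε.2 hw)
    exact ⟨h3, fun hw => by_contra fun hne => h4 ⟨hw, hne⟩⟩
  obtain ⟨ε, ⟨hrad, hε⟩, heq⟩ :=
    ((hrad.and self_mem_nhdsWithin).and (matrixFunction_eq_contourCalculus f B hf)).exists
  have hε : 0 < ε := hε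
  rw [← heq]
  have hdiff : ∀ a ∈ spectrum ℂ B, DifferentiableOn ℂ f (Metric.closedBall a ε) :=
    fun a ha w hw => (hrad a ha w hw).1.differentiableWithinAt
  have hsphere : ∀ a ∈ spectrum ℂ B, ∀ w ∈ Metric.sphere a ε, ∀ i ∈ S, w ≠ c i := by
    intro a ha w hw i hi h
    have := (hrad a ha w (Metric.sphere_subset_closedBall hw)).2 (h ▸ hc i hi)
    rw [this] at hw
    simp [hε.ne] at hw
  -- Several c_i may coincide; each still contributes to exactly one circle, the one about a = c_i.
  have hres : ∀ a ∈ spectrum ℂ B, ∀ i ∈ S, ∀ j,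
      (∮ w in C(a, ε), f w * ((w - c i) ^ (j + 1))⁻¹) = if c i = a then
        2 * Real.pi * Complex.I * ((j.factorial : ℂ)⁻¹ * iteratedDeriv j f (c i)) else 0 := by
    intro a ha i hi j
    split_ifs with h
    · subst h
      exact circleIntegral_mul_inv_pow_self hε (hdiff _ ha) j
    · exact circleIntegral_mul_inv_pow_of_ne hε (hdiff _ ha)
        (fun hm => h ((hrad a ha _ hm).2 (hc i hi))) j
  have hint : ∀ a ∈ spectrum ℂ B, ∀ i ∈ S, ∀ j,
      CircleIntegrable (fun w => f w * ((w - c i) ^ (j + 1))⁻¹) a ε := by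
    intro a ha i hi j
    refine ContinuousOn.circleIntegrable hε.le ?_
    refine ((hdiff a ha).continuousOn.mono Metric.sphere_subset_closedBall).mul
      (ContinuousOn.inv₀ (by fun_prop) fun w hw => pow_ne_zero _ ?_)
    exact sub_ne_zero.2 (hsphere a ha w hw i hi)
  have hpi : (2 * Real.pi * Complex.I : ℂ) ≠ 0 := Complex.two_pi_I_ne_zero
  have hcircle : ∀ a ∈ spectrum ℂ B, ∀ k l, (2 * Real.pi * Complex.I : ℂ)⁻¹ *
      (∮ z in C(a, ε), f z * ((z • (1 : Matrix (Fin n) (Fin n) ℂ) - B)⁻¹) k l) =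
      ∑ i ∈ S, if c i = a then ∑ j ∈ Finset.range m,
        ((j.factorial : ℂ)⁻¹ * iteratedDeriv j f (c i)) * ((B - c i • 1) ^ j * E i) k l else 0 := by
    intro a ha k l
    have h1 : (∮ z in C(a, ε), f z * ((z • (1 : Matrix (Fin n) (Fin n) ℂ) - B)⁻¹) k l) =
        ∮ z in C(a, ε), ∑ i ∈ S, ∑ j ∈ Finset.range m,
          ((B - c i • 1) ^ j * E i) k l * (f z * ((z - c i) ^ (j + 1))⁻¹) := by
      refine circleIntegral.integral_congr hε.le fun z hz => ?_
      simp only [inv_smul_one_sub_eq_sum S B c E m hE hnil (hsphere a ha z hz),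
        Matrix.sum_apply, Matrix.smul_apply, smul_eq_mul, Finset.mul_sum]
      exact Finset.sum_congr rfl fun i _ => Finset.sum_congr rfl fun j _ => by ring
    have hint' : ∀ i ∈ S, ∀ j, CircleIntegrable (fun z =>
        ((B - c i • 1) ^ j * E i) k l * (f z * ((z - c i) ^ (j + 1))⁻¹)) a ε :=
      fun i hi j => (hint a ha i hi j).const_smul (a := ((B - c i • 1) ^ j * E i) k l)
    rw [h1, circleIntegral.integral_fun_sum fun i hi =>
      CircleIntegrable.fun_sum _ fun j _ => hint' i hi j, Finset.mul_sum]
    refine Finset.sum_congr rfl fun i hi => ?_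
    rw [circleIntegral.integral_fun_sum fun j _ => hint' i hi j, Finset.mul_sum]
    simp only [circleIntegral.integral_const_mul, hres a ha i hi]
    split_ifs
    · refine Finset.sum_congr rfl fun j _ => ?_
      field_simp
    · simp
  ext k l
  rw [contourCalculus, Matrix.sum_apply]
  simp only [Matrix.of_apply]
  rw [Finset.sum_congr rfl fun a ha => hcircle a (by simpa using ha) k l, Finset.sum_comm,
    Matrix.sum_apply]
  refine Finset.sum_congr rfl fun i hi => ?_
  rw [Finset.sum_ite_eq, if_pos (by simpa using hc i hi), Matrix.sum_apply]
  simp only [Matrix.smul_apply, smul_eq_mul]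

/-- A resolution of the identity into matrices annihilated by powers of `A - c`, where `c` runs over
the eigenvalues of `A`. -/
theorem exists_spectral_resolution {n : ℕ} (A : Matrix (Fin n) (Fin n) ℂ) :
    ∃ E : ℂ → Matrix (Fin n) (Fin n) ℂ,
      ∑ c ∈ (Matrix.finite_spectrum A).toFinset, E c = 1 ∧
      ∀ c ∈ (Matrix.finite_spectrum A).toFinset, (A - c • 1) ^ n * E c = 0 := by
  classical
  rcases Nat.eq_zero_or_pos n with rfl | hn
  · exact ⟨0, Subsingleton.elim _ _, fun _ _ => Subsingleton.elim _ _⟩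
  have : Nonempty (Fin n) := ⟨⟨0, hn⟩⟩
  set S := (Matrix.finite_spectrum A).toFinset with hS
  have hSne : S.Nonempty := by
    obtain ⟨c, hc⟩ := spectrum.nonempty_of_isAlgClosed_of_finiteDimensional ℂ A
    exact ⟨c, by simpa [hS] using hc⟩
  -- The exponent n dominates every algebraic multiplicity, so the characteristic polynomial divides
  -- the product of the q_c, and Cayley–Hamilton annihilates it at A.
  let q : ℂ → Polynomial ℂ := fun c => (Polynomial.X - Polynomial.C c) ^ n
  have hcop : Pairwise (Function.onFun IsCoprime fun i : S => q i) := fun i j hij =>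
    (Polynomial.pairwise_coprime_X_sub_C (s := fun c : ℂ => c) Function.injective_id
      (fun h => hij (Subtype.ext h))).pow
  -- Bézout: the sum of μ_c ∏_{j ≠ c} q_j is 1. Its terms evaluated at A are the matrices E_c.
  obtain ⟨μ, hμ⟩ := (exists_sum_eq_one_iff_pairwise_coprime hSne).2 hcop
  have hroots : A.charpoly.roots.toFinset = S := by
    ext c
    rw [Multiset.mem_toFinset, Polynomial.mem_roots A.charpoly_monic.ne_zero,
      ← Matrix.mem_spectrum_iff_isRoot_charpoly]
    simp [hS]
  have hann : Polynomial.aeval A (∏ c ∈ S, q c) = 0 := by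
    have hdvd : A.charpoly ∣ ∏ c ∈ S, q c := by
      have hcard : A.charpoly.roots.card = n := by
        rw [← (IsAlgClosed.splits A.charpoly).natDegree_eq_card_roots,
          Matrix.charpoly_natDegree_eq_dim, Fintype.card_fin]
      rw [← Polynomial.prod_multiset_X_sub_C_of_monic_of_roots_card_eq A.charpoly_monic
        (by rw [hcard, Matrix.charpoly_natDegree_eq_dim, Fintype.card_fin]),
        Finset.prod_multiset_map_count, hroots]
      exact Finset.prod_dvd_prod_of_dvd _ _ fun c _ =>
        pow_dvd_pow _ ((Multiset.count_le_card _ _).trans_eq hcard)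
    obtain ⟨p, hp⟩ := hdvd
    rw [hp, map_mul, Matrix.aeval_self_charpoly, zero_mul]
  refine ⟨fun c => Polynomial.aeval A (μ c * ∏ j ∈ S \ {c}, q j), ?_, fun c hc => ?_⟩
  · rw [← map_sum, hμ, map_one]
  · have h1 : (A - c • 1) ^ n = Polynomial.aeval A (q c) := by
      simp [q, Algebra.algebraMap_eq_smul_one]
    rw [h1, ← map_mul, mul_left_comm, Finset.sdiff_singleton_eq_erase,
      Finset.mul_prod_erase S q hc, map_mul, hann, mul_zero]

/-- Substitution of an affine function of a matrix. -/
theorem matrixFunction_affine_eq_sum {n : ℕ} (A : Matrix (Fin n) (Fin n) ℂ)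
    (E : ℂ → Matrix (Fin n) (Fin n) ℂ) (m : ℕ)
    (hE : ∑ c ∈ (Matrix.finite_spectrum A).toFinset, E c = 1)
    (hnil : ∀ c ∈ (Matrix.finite_spectrum A).toFinset, (A - c • 1) ^ m * E c = 0) (α t : ℂ)
    (f : ℂ → ℂ) (hf : ∀ c ∈ spectrum ℂ A, AnalyticAt ℂ f (α + t * c)) :
    matrixFunction f (α • (1 : Matrix (Fin n) (Fin n) ℂ) + t • A) =
      ∑ c ∈ (Matrix.finite_spectrum A).toFinset, ∑ j ∈ Finset.range m,
        ((j.factorial : ℂ)⁻¹ * (t ^ j * iteratedDeriv j f (α + t * c))) •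
          ((A - c • 1) ^ j * E c) := by
  rcases Nat.eq_zero_or_pos n with rfl | hn
  · exact Subsingleton.elim _ _
  have : Nonempty (Fin n) := ⟨⟨0, hn⟩⟩
  have hB : α • (1 : Matrix (Fin n) (Fin n) ℂ) + t • A =
      Polynomial.aeval A (Polynomial.C α + Polynomial.C t * Polynomial.X) := by
    simp [Algebra.algebraMap_eq_smul_one]
  have hspec : spectrum ℂ (α • (1 : Matrix (Fin n) (Fin n) ℂ) + t • A) =
      (fun c => α + t * c) '' spectrum ℂ A := by
    rw [hB, spectrum.map_polynomial_aeval_of_nonempty _ _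
      (spectrum.nonempty_of_isAlgClosed_of_finiteDimensional ℂ A)]
    simp
  have hsub : ∀ c : ℂ, α • (1 : Matrix (Fin n) (Fin n) ℂ) + t • A - (α + t * c) • 1 =
      t • (A - c • 1) := by
    intro c
    rw [add_smul, smul_sub, smul_smul]
    abel
  -- The resolution of A also serves α + tA, even for t = 0, when all the points α + tc coincide.
  rw [matrixFunction_eq_sum (Matrix.finite_spectrum A).toFinset _ (fun c => α + t * c) E m hE]
  · refine Finset.sum_congr rfl fun c _ => Finset.sum_congr rfl fun j _ => ?_
    rw [hsub, smul_pow, smul_mul_assoc, smul_smul]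
    congr 1
    ring
  · intro c hc
    rw [hsub, smul_pow, smul_mul_assoc, hnil c hc, smul_zero]
  · intro c hc
    rw [hspec]
    exact ⟨c, by simpa using hc, rfl⟩
  · rw [hspec]
    rintro _ ⟨c, hc, rfl⟩
    exact hf c hc

/-! ### Algebraic rules of the functional calculus -/

theorem matrixFunction_congr {n : ℕ} (A : Matrix (Fin n) (Fin n) ℂ) {f g : ℂ → ℂ}
    (hf : AnalyticOnNhd ℂ f (spectrum ℂ A)) (hfg : ∀ c ∈ spectrum ℂ A, f =ᶠ[𝓝 c] g) :
    matrixFunction f A = matrixFunction g A := by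
  obtain ⟨E, hE, hnil⟩ := exists_spectral_resolution A
  have hg : AnalyticOnNhd ℂ g (spectrum ℂ A) := fun c hc => (hf c hc).congr (hfg c hc)
  have hmem : ∀ c ∈ (Matrix.finite_spectrum A).toFinset, c ∈ spectrum ℂ A := by simp
  rw [matrixFunction_eq_sum _ A (fun c => c) E n hE hnil hmem f hf,
    matrixFunction_eq_sum _ A (fun c => c) E n hE hnil hmem g hg]
  refine Finset.sum_congr rfl fun c hc => Finset.sum_congr rfl fun j _ => ?_
  rw [(hfg c (hmem c hc)).iteratedDeriv_eq]

theorem matrixFunction_const_mul {n : ℕ} (A : Matrix (Fin n) (Fin n) ℂ) (a : ℂ) {f : ℂ → ℂ}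
    (hf : AnalyticOnNhd ℂ f (spectrum ℂ A)) :
    matrixFunction (fun w => a * f w) A = a • matrixFunction f A := by
  obtain ⟨E, hE, hnil⟩ := exists_spectral_resolution A
  have hmem : ∀ c ∈ (Matrix.finite_spectrum A).toFinset, c ∈ spectrum ℂ A := by simp
  rw [matrixFunction_eq_sum _ A (fun c => c) E n hE hnil hmem f hf,
    matrixFunction_eq_sum _ A (fun c => c) E n hE hnil hmem _ (analyticOnNhd_const.mul hf),
    Finset.smul_sum]
  refine Finset.sum_congr rfl fun c hc => ?_
  rw [Finset.smul_sum]
  refine Finset.sum_congr rfl fun j _ => ?_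
  rw [iteratedDeriv_const_mul_field, smul_smul]
  congr 1
  ring

theorem matrixFunction_add {n : ℕ} (A : Matrix (Fin n) (Fin n) ℂ) {f g : ℂ → ℂ}
    (hf : AnalyticOnNhd ℂ f (spectrum ℂ A)) (hg : AnalyticOnNhd ℂ g (spectrum ℂ A)) :
    matrixFunction (fun w => f w + g w) A = matrixFunction f A + matrixFunction g A := by
  obtain ⟨E, hE, hnil⟩ := exists_spectral_resolution A
  have hmem : ∀ c ∈ (Matrix.finite_spectrum A).toFinset, c ∈ spectrum ℂ A := by simp
  rw [matrixFunction_eq_sum _ A (fun c => c) E n hE hnil hmem f hf,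
    matrixFunction_eq_sum _ A (fun c => c) E n hE hnil hmem g hg,
    matrixFunction_eq_sum _ A (fun c => c) E n hE hnil hmem (fun w => f w + g w) (hf.add hg),
    ← Finset.sum_add_distrib]
  refine Finset.sum_congr rfl fun c hc => ?_
  rw [← Finset.sum_add_distrib]
  refine Finset.sum_congr rfl fun j _ => ?_
  rw [← add_smul, iteratedDeriv_fun_add (hf c (hmem c hc)).contDiffAt
    (hg c (hmem c hc)).contDiffAt, mul_add]

/-- On the range of E_c, A acts as c plus the nilpotent A - c, which matches the Leibniz rule
(wf)^(j) = w f^(j) + j f^(j-1) after a shift of the index. -/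
theorem matrixFunction_id_mul {n : ℕ} (A : Matrix (Fin n) (Fin n) ℂ) {f : ℂ → ℂ}
    (hf : AnalyticOnNhd ℂ f (spectrum ℂ A)) :
    matrixFunction (fun w => w * f w) A = A * matrixFunction f A := by
  obtain ⟨E, hE, hnil⟩ := exists_spectral_resolution A
  have hmem : ∀ c ∈ (Matrix.finite_spectrum A).toFinset, c ∈ spectrum ℂ A := by simp
  rw [matrixFunction_eq_sum _ A (fun c => c) E n hE hnil hmem f hf,
    matrixFunction_eq_sum _ A (fun c => c) E n hE hnil hmem _ (analyticOnNhd_id.mul hf),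
    Finset.mul_sum]
  refine Finset.sum_congr rfl fun c hc => ?_
  let V : Set ℂ := {w | AnalyticAt ℂ f w}
  have hV : IsOpen V := isOpen_analyticAt ℂ f
  have hcV : c ∈ V := hf c (hmem c hc)
  -- For j = 0 the truncated index j - 1 is harmless, since its factor j is zero.
  have hder : ∀ j, iteratedDeriv j (fun w => w * f w) c =
      c * iteratedDeriv j f c + j * iteratedDeriv (j - 1) f c := by
    intro j
    cases j with
    | zero => simp
    | succ j =>
      have := iteratedDeriv_succ_sub_mul hV (g := f) (h := fun w => w * f w) (a := 0)
        (fun w hw => hw) (fun w _ => by simp) j c hcV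
      simpa using this
  have hA : ∀ j, A * ((A - c • 1) ^ j * E c) =
      c • ((A - c • 1) ^ j * E c) + (A - c • 1) ^ (j + 1) * E c := by
    intro j
    rw [pow_succ', mul_assoc (A - c • 1), sub_mul, smul_mul_assoc, one_mul]
    abel
  -- The shift leaves one boundary term, a multiple of (A-c)^m E_c, which vanishes for m = n.
  have hshift : ∀ m : ℕ, ∑ j ∈ Finset.range m,
      ((j.factorial : ℂ)⁻¹ * iteratedDeriv j (fun w => w * f w) c) • ((A - c • 1) ^ j * E c) +
        ((m.factorial : ℂ)⁻¹ * (m * iteratedDeriv (m - 1) f c)) • ((A - c • 1) ^ m * E c) =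
      A * ∑ j ∈ Finset.range m,
        ((j.factorial : ℂ)⁻¹ * iteratedDeriv j f c) • ((A - c • 1) ^ j * E c) := by
    intro m
    induction m with
    | zero => simp
    | succ m ih =>
      rw [Finset.sum_range_succ, Finset.sum_range_succ, mul_add, ← ih, hder m, mul_smul_comm, hA,
        Nat.factorial_succ, Nat.add_sub_cancel]
      have hm : ((m : ℂ) + 1) ≠ 0 := by exact_mod_cast m.succ_ne_zero
      have h1 : (((m + 1) * m.factorial : ℕ) : ℂ)⁻¹ * (((m + 1 : ℕ) : ℂ) * iteratedDeriv m f c) =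
          (m.factorial : ℂ)⁻¹ * iteratedDeriv m f c := by
        push_cast
        field_simp
      rw [h1]
      module
  have := hshift n
  rw [hnil c hc, smul_zero, add_zero] at this
  exact this

/-- Multiplicativity of the functional calculus, for one polynomial factor. -/
theorem matrixFunction_polynomial_mul {n : ℕ} (A : Matrix (Fin n) (Fin n) ℂ) (p : Polynomial ℂ)
    {f : ℂ → ℂ} (hf : AnalyticOnNhd ℂ f (spectrum ℂ A)) :
    matrixFunction (fun w => p.eval w * f w) A = Polynomial.aeval A p * matrixFunction f A := by
  have hpoly : ∀ p : Polynomial ℂ, AnalyticOnNhd ℂ (fun w => p.eval w * f w) (spectrum ℂ A) :=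
    fun p => (AnalyticOnNhd.eval_polynomial p).mono (Set.subset_univ _) |>.mul hf
  induction p using Polynomial.induction_on with
  | C a =>
    simp only [Polynomial.eval_C, Polynomial.aeval_C]
    rw [matrixFunction_const_mul A a hf, Algebra.algebraMap_eq_smul_one, smul_mul_assoc, one_mul]
  | add p q hp hq =>
    simp only [Polynomial.eval_add, add_mul, map_add]
    rw [matrixFunction_add A (hpoly p) (hpoly q), hp, hq]
  | monomial k a ih =>
    have h1 : (fun w => (Polynomial.C a * Polynomial.X ^ (k + 1)).eval w * f w) =
        fun w => w * ((Polynomial.C a * Polynomial.X ^ k).eval w * f w) := by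
      ext w
      simp only [Polynomial.eval_mul, Polynomial.eval_C, Polynomial.eval_pow, Polynomial.eval_X]
      ring
    rw [h1, matrixFunction_id_mul A (hpoly _), ih, ← mul_assoc]
    congr 1
    rw [show Polynomial.C a * Polynomial.X ^ (k + 1) =
      Polynomial.X * (Polynomial.C a * Polynomial.X ^ k) by ring, map_mul _ Polynomial.X,
      Polynomial.aeval_X]

theorem isUnit_aeval_of_eval_ne_zero {n : ℕ} (A : Matrix (Fin n) (Fin n) ℂ) (v : Polynomial ℂ)
    (hv : ∀ c ∈ spectrum ℂ A, v.eval c ≠ 0) : IsUnit (Polynomial.aeval A v) := by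
  rcases Nat.eq_zero_or_pos n with rfl | hn
  · exact isUnit_of_subsingleton _
  have : Nonempty (Fin n) := ⟨⟨0, hn⟩⟩
  rw [← spectrum.zero_notMem_iff ℂ, spectrum.map_polynomial_aeval_of_nonempty _ _
    (spectrum.nonempty_of_isAlgClosed_of_finiteDimensional ℂ A)]
  rintro ⟨c, hc, h⟩
  exact hv c hc h

/-! ### The remainder of rational interpolation -/

theorem iteratedDeriv_polynomial_eval (u : Polynomial ℂ) (p : ℕ) :
    iteratedDeriv p (fun w => u.eval w) = fun w => (Polynomial.derivative^[p] u).eval w := by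
  induction p with
  | zero => simp
  | succ p ih =>
    ext w
    rw [iteratedDeriv_succ, ih, Polynomial.deriv, Function.iterate_succ_apply']

theorem eval_nodePolynomial {N : ℕ} (z : Fin N → ℂ) (w : ℂ) :
    (nodePolynomial z).eval w = ((List.ofFn z).map fun a => w - a).prod := by
  rw [List.map_ofFn, List.prod_ofFn, nodePolynomial, Polynomial.eval_prod]
  simp

theorem count_ofFn_eq_nodeMultiplicity {N : ℕ} (z : Fin N → ℂ) (k : Fin N) :
    (List.ofFn z).count (z k) = nodeMultiplicity z k := by
  rw [nodeMultiplicity, Nat.card_eq_fintype_card, Fintype.card_subtype, ← Multiset.coe_count,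
    ← Fin.univ_val_map, Multiset.count_map, ← Finset.filter_val, Finset.card_val]
  simp only [eq_comm]

/-- The remainder of Hermite interpolation is divisible by the node polynomial. -/
theorem Interpolates.exists_remainder {N : ℕ} {z : Fin N → ℂ} {U : Set ℂ} (hU : IsOpen U)
    (hz : ∀ k, z k ∈ U) {f : ℂ → ℂ} (hf : AnalyticOnNhd ℂ f U) {u v : Polynomial ℂ}
    (hinterp : Interpolates (fun w => u.eval w / v.eval w) f z) (hv : ∀ k, v.eval (z k) ≠ 0) :
    ∃ φ : ℂ → ℂ, AnalyticOnNhd ℂ φ U ∧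
      ∀ w ∈ U, v.eval w * f w - u.eval w = ((List.ofFn z).map fun a => w - a).prod * φ w := by
  have hpoly : ∀ (p : Polynomial ℂ) (x : ℂ), AnalyticAt ℂ (fun w => p.eval w) x := fun p x =>
    AnalyticOnNhd.eval_polynomial p x (Set.mem_univ x)
  refine exists_analyticOnNhd_prod_mul_eq hU _ (fun a ha => ?_) _
    (fun w hw => ((hpoly v w).mul (hf w hw)).sub (hpoly u w)) (fun a ha => ?_)
  · obtain ⟨k, rfl⟩ := List.mem_ofFn.1 ha
    exact hz k
  · obtain ⟨k, rfl⟩ := List.mem_ofFn.1 ha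
    rw [count_ofFn_eq_nodeMultiplicity]
    have hr : AnalyticAt ℂ (fun w => u.eval w / v.eval w) (z k) :=
      (hpoly u _).div (hpoly v _) (hv k)
    have hd : AnalyticAt ℂ (fun w => f w - u.eval w / v.eval w) (z k) := (hf _ (hz k)).sub hr
    have hord : (nodeMultiplicity z k : ℕ∞) ≤
        analyticOrderAt (fun w => f w - u.eval w / v.eval w) (z k) := by
      rw [natCast_le_analyticOrderAt_iff_iteratedDeriv_eq_zero hd]
      intro j hj
      rw [iteratedDeriv_fun_sub (hf _ (hz k)).contDiffAt hr.contDiffAt, hinterp k j hj, sub_self]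
    -- The identity vf - u = v(f - r) is needed only near z_k, where v has no zeros; multiplication
    -- by v cannot lower the order of vanishing.
    have heq : (fun w => v.eval w * f w - u.eval w) =ᶠ[𝓝 (z k)]
        (fun w => v.eval w) * fun w => f w - u.eval w / v.eval w := by
      filter_upwards [(hpoly v (z k)).continuousAt.eventually_ne (hv k)] with w hw
      simp only [Pi.mul_apply]
      field_simp
    rw [analyticOrderAt_congr heq, analyticOrderAt_mul (hpoly v _) hd]
    exact hord.trans le_add_self

/-- Applying the calculus to vf = Ωφ + u and to v(u/v) = u leaves only the cancellation of v(A),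
which is invertible and commutes with Ω(A). -/
theorem matrixFunction_sub_rational_eq {n N : ℕ} (A : Matrix (Fin n) (Fin n) ℂ) {z : Fin N → ℂ}
    {U : Set ℂ} (hU : IsOpen U) (hAU : spectrum ℂ A ⊆ U) {f φ : ℂ → ℂ} (hf : AnalyticOnNhd ℂ f U)
    (hφ : AnalyticOnNhd ℂ φ U) {u v : Polynomial ℂ} (hvA : ∀ c ∈ spectrum ℂ A, v.eval c ≠ 0)
    (hfφ : ∀ w ∈ U, v.eval w * f w - u.eval w = (nodePolynomial z).eval w * φ w) :
    matrixFunction f A - matrixFunction (fun w => u.eval w / v.eval w) A =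
      Polynomial.aeval A (nodePolynomial z) * (Polynomial.aeval A v)⁻¹ * matrixFunction φ A := by
  have hpoly : ∀ p : Polynomial ℂ, AnalyticOnNhd ℂ (fun w => p.eval w) (spectrum ℂ A) := fun p =>
    (AnalyticOnNhd.eval_polynomial p).mono (Set.subset_univ _)
  have hr : AnalyticOnNhd ℂ (fun w => u.eval w / v.eval w) (spectrum ℂ A) := fun c hc =>
    (hpoly u c hc).div (hpoly v c hc) (hvA c hc)
  have hfA := hf.mono hAU
  have hφA := hφ.mono hAU
  have h1 : Polynomial.aeval A v * matrixFunction f A =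
      Polynomial.aeval A (nodePolynomial z) * matrixFunction φ A +
        matrixFunction (fun w => u.eval w) A := by
    rw [← matrixFunction_polynomial_mul A v hfA, ← matrixFunction_polynomial_mul A _ hφA,
      ← matrixFunction_add A ((hpoly _).mul hφA) (hpoly u)]
    refine matrixFunction_congr A ((hpoly v).mul hfA) fun c hc => ?_
    filter_upwards [hU.mem_nhds (hAU hc)] with w hw
    simp [← hfφ w hw]
  have h2 : Polynomial.aeval A v * matrixFunction (fun w => u.eval w / v.eval w) A =
      matrixFunction (fun w => u.eval w) A := by
    rw [← matrixFunction_polynomial_mul A v hr]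
    refine matrixFunction_congr A ((hpoly v).mul hr) fun c hc => ?_
    filter_upwards [(hpoly v c hc).continuousAt.eventually_ne (hvA c hc)] with w hw
    field_simp
  have hdet := (Matrix.isUnit_iff_isUnit_det _).1 (isUnit_aeval_of_eval_ne_zero A v hvA)
  have hcomm : Polynomial.aeval A (nodePolynomial z) * (Polynomial.aeval A v)⁻¹ =
      (Polynomial.aeval A v)⁻¹ * Polynomial.aeval A (nodePolynomial z) := by
    calc _ = (Polynomial.aeval A v)⁻¹ * (Polynomial.aeval A v *
          Polynomial.aeval A (nodePolynomial z)) * (Polynomial.aeval A v)⁻¹ := by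
          rw [← mul_assoc, Matrix.nonsing_inv_mul _ hdet, one_mul]
      _ = _ := by
          rw [← map_mul, mul_comm v, map_mul, mul_assoc, mul_assoc,
            Matrix.mul_nonsing_inv _ hdet, mul_one]
  rw [hcomm, mul_assoc, ← sub_eq_of_eq_add h1, ← h2, ← mul_sub, ← mul_assoc,
    Matrix.nonsing_inv_mul _ hdet, one_mul]

/-! ### The error estimate -/

theorem theoremt {n N : ℕ} (hN : 0 < N) (A : Matrix (Fin n) (Fin n) ℂ) (z : Fin N → ℂ)
    (U : Set ℂ) (hU : IsOpen U) (hKU : convexHull ℝ (spectrum ℂ A ∪ Set.range z) ⊆ U)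
    (f : ℂ → ℂ) (hf : AnalyticOnNhd ℂ f U)
    (u v : Polynomial ℂ) (hL : u.natDegree ≤ N - 1)
    (hinterp : Interpolates (fun w => u.eval w / v.eval w) f z)
    (hvz : ∀ k, v.eval (z k) ≠ 0) (hvA : ∀ c ∈ spectrum ℂ A, v.eval c ≠ 0)
    (ξ : Matrix (Fin n) (Fin n) ℂ →ₗ[ℂ] ℂ) :
    ∃ m : ℝ,
      IsGreatest {x : ℝ | ∃ t ∈ Set.Icc (0 : ℝ) 1, ∃ μ ∈ convexHull ℝ (Set.range z),
        x = ‖ξ (remainderMatrix A z f v t μ)‖} m ∧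
      ‖ξ (matrixFunction f A - matrixFunction (fun w => u.eval w / v.eval w) A)‖ ≤ m := by
  set K := convexHull ℝ (spectrum ℂ A ∪ Set.range z) with hKdef
  set K' := convexHull ℝ (Set.range z) with hK'def
  have hK : Convex ℝ K := convex_convexHull ℝ _
  have hK' : Convex ℝ K' := convex_convexHull ℝ _
  have hK'K : K' ⊆ K := convexHull_mono Set.subset_union_right
  have hAK : spectrum ℂ A ⊆ K := Set.subset_union_left.trans (subset_convexHull ℝ _)
  have hzK' : ∀ k, z k ∈ K' := fun k => subset_convexHull ℝ _ (Set.mem_range_self k)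
  have hne : K'.Nonempty := ⟨z ⟨0, hN⟩, hzK' _⟩
  have hmem : ∀ t ∈ Set.Icc (0 : ℝ) 1, ∀ μ ∈ K', ∀ c ∈ spectrum ℂ A,
      (1 - (t : ℂ)) * μ + t * c ∈ U := by
    intro t ht μ hμ c hc
    apply hKU
    have := hK (hK'K hμ) (hAK hc) (sub_nonneg.2 ht.2) ht.1 (by ring)
    simpa using this
  have hvU : AnalyticOnNhd ℂ (fun w => v.eval w) U :=
    (AnalyticOnNhd.eval_polynomial v).mono (Set.subset_univ _)
  have huU : AnalyticOnNhd ℂ (fun w => u.eval w) U :=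
    (AnalyticOnNhd.eval_polynomial u).mono (Set.subset_univ _)
  have hg : AnalyticOnNhd ℂ (fun w => v.eval w * f w) U := hvU.mul hf
  obtain ⟨φ, hφ, hφeq⟩ :=
    hinterp.exists_remainder hU (fun k => hKU (hK'K (hzK' k))) hf hvz
  obtain ⟨E, hE, hnil⟩ := exists_spectral_resolution A
  set S := (Matrix.finite_spectrum A).toFinset with hS
  have hSA : ∀ c ∈ S, c ∈ spectrum ℂ A := by simp [hS]
  let b : ℂ → ℕ → ℂ := fun c j => (j.factorial : ℂ)⁻¹ *
    ξ (Polynomial.aeval A (nodePolynomial z) * (Polynomial.aeval A v)⁻¹ *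
      ((A - c • 1) ^ j * E c))
  have hrem : ∀ t ∈ Set.Icc (0 : ℝ) 1, ∀ μ ∈ K', ξ (remainderMatrix A z f v t μ) =
      (N.factorial : ℂ)⁻¹ * ∑ c ∈ S, ∑ j ∈ Finset.range n, b c j * (t : ℂ) ^ j *
        iteratedDeriv (N + j) (fun w => v.eval w * f w) ((1 - (t : ℂ)) * μ + t * c) := by
    intro t ht μ hμ
    rw [remainderMatrix, matrixFunction_affine_eq_sum A E n hE hnil _ _ _
      fun c hc => hg.analyticOnNhd_iteratedDeriv N _ (hmem t ht μ hμ c hc),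
      mul_smul_comm, map_smul, smul_eq_mul]
    simp only [Finset.mul_sum, map_sum, mul_smul_comm, map_smul, smul_eq_mul,
      iteratedDeriv_iteratedDeriv]
    refine Finset.sum_congr rfl fun c _ => Finset.sum_congr rfl fun j _ => ?_
    simp only [b]
    ring
  have hleft : ξ (matrixFunction f A - matrixFunction (fun w => u.eval w / v.eval w) A) =
      ∑ c ∈ S, ∑ j ∈ Finset.range n, b c j * iteratedDeriv j φ c := by
    rw [matrixFunction_sub_rational_eq A (z := z) hU (hAK.trans hKU) hf hφ hvA
      (fun w hw => by rw [hφeq w hw, eval_nodePolynomial]),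
      matrixFunction_eq_sum S A (fun c => c) E n hE hnil hSA φ (hφ.mono (hAK.trans hKU))]
    simp only [Finset.mul_sum, map_sum, mul_smul_comm, map_smul, smul_eq_mul]
    refine Finset.sum_congr rfl fun c _ => Finset.sum_congr rfl fun j _ => ?_
    simp only [b]
    ring
  -- Continuity is read off from the finite sum in `hrem`, as the definition of the matrix function
  -- by a limit does not show it.
  have hcont : ContinuousOn (fun q : ℝ × ℂ => ‖ξ (remainderMatrix A z f v q.1 q.2)‖)
      (Set.Icc (0 : ℝ) 1 ×ˢ K') := by
    refine ContinuousOn.norm (ContinuousOn.congr ?_ fun q hq => hrem q.1 hq.1 q.2 hq.2)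
    refine continuousOn_const.mul (continuousOn_finsetSum _ fun c hc =>
      continuousOn_finsetSum _ fun j _ => ContinuousOn.mul (by fun_prop) ?_)
    exact (hg.analyticOnNhd_iteratedDeriv (N + j)).continuousOn.comp (by fun_prop)
      fun q hq => hmem q.1 hq.1 q.2 hq.2 c (hSA c hc)
  obtain ⟨⟨t₀, μ₀⟩, hq₀, hmax⟩ := (isCompact_Icc.prod
    ((Set.finite_range z).isCompact_convexHull ℝ)).exists_isMaxOn
      ((Set.nonempty_Icc.2 zero_le_one).prod hne) hcont
  have hle : ∀ t ∈ Set.Icc (0 : ℝ) 1, ∀ μ ∈ K',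
      ‖ξ (remainderMatrix A z f v t μ)‖ ≤ ‖ξ (remainderMatrix A z f v t₀ μ₀)‖ :=
    fun t ht μ hμ => isMaxOn_iff.1 hmax (t, μ) (Set.mk_mem_prod ht hμ)
  refine ⟨‖ξ (remainderMatrix A z f v t₀ μ₀)‖, ⟨⟨t₀, hq₀.1, μ₀, hq₀.2, rfl⟩, ?_⟩, ?_⟩
  · rintro _ ⟨t, ht, μ, hμ, rfl⟩
    exact hle t ht μ hμ
  · rw [hleft]
    have hfact : (0 : ℝ) < N.factorial := by exact_mod_cast N.factorial_pos
    -- Since N > 0, deg u ≤ N - 1 gives deg u < N + j, so u drops out.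
    have hder : ∀ j, ∀ w ∈ U, iteratedDeriv (N + j) (fun w => v.eval w * f w - u.eval w) w =
        iteratedDeriv (N + j) (fun w => v.eval w * f w) w := by
      intro j w hw
      rw [iteratedDeriv_fun_sub (hg w hw).contDiffAt (huU w hw).contDiffAt,
        iteratedDeriv_polynomial_eval, Polynomial.iterate_derivative_eq_zero (by omega)]
      simp
    -- The bound is N! times the maximum, because the remainder matrix already carries 1/N!; the
    -- factor 1/N! in the estimate cancels it.
    have key := norm_sum_iteratedDeriv_le_of_prod_factor S hU hK hKU hK' hK'K hne n b (fun c => c)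
      (fun c hc => hAK (hSA c hc)) hφ (List.ofFn z) (fun a ha => by
        obtain ⟨k, rfl⟩ := List.mem_ofFn.1 ha
        exact hzK' k) _ hφeq
      (N.factorial * ‖ξ (remainderMatrix A z f v t₀ μ₀)‖) (fun t ht μ hμ => by
        refine le_trans (le_of_eq ?_) (mul_le_mul_of_nonneg_left (hle t ht μ hμ) hfact.le)
        rw [hrem t ht μ hμ, norm_mul, norm_inv, Complex.norm_natCast,
          mul_inv_cancel_left₀ hfact.ne']
        congr 1
        refine Finset.sum_congr rfl fun c hc => Finset.sum_congr rfl fun j _ => ?_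
        rw [List.length_ofFn, hder j _ (hmem t ht μ hμ c (hSA c hc))])
    rwa [List.length_ofFn, mul_div_cancel_left₀ _ hfact.ne'] at key
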